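/- Let $(X_1,Y_1),(X_2,Y_2),\dots$ be independent, identically distributed random pairs from the model $Y_i=a_0X_i+b_0+\epsilon_i$, where $a_0,b_0\in\mathbb{R}$, and where $X_i$ is independent of $\epsilon_i$ and is not almost surely constant. Suppose that $\epsilon_i$ has a bounded density $f$ with respect to Lebesgue measure that is symmetric, $f(x)=f(-x)$ for all $x$, and strictly unimodal, that is, $f$ attains its maximum only at $x=0$, is strictly increasing on $(-\infty,0]$ and strictly decreasing on $[0,\infty)$. For $r>0$, $n\ge 1$ and $\theta=(a,b)\in\mathbb{R}^2$ put $$M_{r,n}(\theta)=\frac1n\sum_{i=1}^n \mathbf{1}\bigl\{|X_ia+b-Y_i|^2\le r^2(X_i^2+1)\bigr\},$$ and let the Hough transform estimator $\hat\theta_{r,n}$ be any maximizer of $M_{r,n}$ over $\mathbb{R}^2$. Then, for every fixed $r>0$ and every such choice of maximizers, $\hat\theta_{r,n}\to\theta_0=(a_0,b_0)$ almost surely as $n\to\infty$. No moment assumption on $X_i$ or $\epsilon_i$ is made. -/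

import Mathlib

open MeasureTheory ProbabilityTheory Filter Topology

/-- The template `D_θ` of the Hough transform with cell radius `r`: the set of points `(x, y)` of
the plane with `|x a + b - y|² ≤ r² (x² + 1)`, where `θ = (a, b)`. -/
def houghTemplate (r : ℝ) (θ : ℝ × ℝ) : Set (ℝ × ℝ) :=
  {p | |p.1 * θ.1 + θ.2 - p.2| ^ 2 ≤ r ^ 2 * (p.1 ^ 2 + 1)}

/-- The objective function `M_{r,n}(θ)`: the fraction of the first `n` data points
that lie in the template `D_θ`. -/
noncomputable def houghObjective (r : ℝ) (n : ℕ) (data : ℕ → ℝ × ℝ) (θ : ℝ × ℝ) : ℝ :=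
  (1 / (n : ℝ)) * ∑ i ∈ Finset.range n, (houghTemplate r θ).indicator (fun _ => (1 : ℝ)) (data i)

/-- `θ` is a value of the Hough transform estimator computed from the first `n` data points:
a (global) maximizer of the objective function. -/
def IsHoughEstimate (r : ℝ) (n : ℕ) (data : ℕ → ℝ × ℝ) (θ : ℝ × ℝ) : Prop :=
  ∀ θ' : ℝ × ℝ, houghObjective r n data θ' ≤ houghObjective r n data θ

/-- Strict unimodality (with mode `0`): `f` has a maximum at the unique point `0` and strictly
decreases in either direction as its argument moves away from `0`. -/
def StrictlyUnimodal (f : ℝ → ℝ) : Prop :=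
  (∀ x : ℝ, x ≠ 0 → f x < f 0) ∧ StrictMonoOn f (Set.Iic 0) ∧ StrictAntiOn f (Set.Ici 0)

/-- `f` is a probability density (with respect to Lebesgue measure) of the real random
variable `ξ`. -/
def IsDensityOf {Ω : Type*} [MeasurableSpace Ω] (P : Measure Ω) (ξ : Ω → ℝ) (f : ℝ → ℝ) : Prop :=
  Measurable f ∧ (∀ x, 0 ≤ f x) ∧
    P.map ξ = (volume : Measure ℝ).withDensity (fun x => ENNReal.ofReal (f x))

/-! Given `X = x`, a template is a window of half-width `r * √(x ^ 2 + 1)` for the noise, centred at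
0 for the true parameter and displaced otherwise. Symmetry and strict unimodality make the centred
window strictly likelier (`withDensity_shifted_window_lt`). A different line meets the true one at
no more than one abscissa, where `X` is not concentrated, so integrating over `X` keeps the
inequality strict (`map_linear_model_lt`).

To make this uniform in the parameter without moments, call a set of parameters dominated if almost
surely, for large `n`, the true parameter beats all of it. One envelope set of small probability and
the strong law give domination (`exists_isHoughDominated`). Dominated sets form an ideal, so if the
parameters far from the truth were not dominated, some ultrafilter on them would contain no
dominated set. Along it the parameter converges, or it escapes to infinity and its templates retain
at most a segment of one vertical line. Each limit set is less likely than the true template, so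
some member of the ultrafilter is dominated, a contradiction (`isHoughDominated_of_le_dist`). -/

theorem mem_houghTemplate_iff {r : ℝ} (hr : 0 ≤ r) (θ p : ℝ × ℝ) :
    p ∈ houghTemplate r θ ↔ |p.1 * θ.1 + θ.2 - p.2| ≤ r * √(p.1 ^ 2 + 1) := by
  have h : r ^ 2 * (p.1 ^ 2 + 1) = (r * √(p.1 ^ 2 + 1)) ^ 2 := by
    rw [mul_pow, Real.sq_sqrt (by positivity)]
  simp only [houghTemplate, Set.mem_ofPred_eq, h]
  exact sq_le_sq₀ (abs_nonneg _) (by positivity)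

theorem measurableSet_houghTemplate (r : ℝ) (θ : ℝ × ℝ) : MeasurableSet (houghTemplate r θ) :=
  measurableSet_le (by fun_prop) (by fun_prop)

/-- The interior of the template of radius `r`. -/
def openHoughTemplate (r : ℝ) (θ : ℝ × ℝ) : Set (ℝ × ℝ) :=
  {p | |p.1 * θ.1 + θ.2 - p.2| < r * √(p.1 ^ 2 + 1)}

theorem isOpen_openHoughTemplate (r : ℝ) (θ : ℝ × ℝ) : IsOpen (openHoughTemplate r θ) :=
  isOpen_lt (by fun_prop) (by fun_prop)

theorem houghTemplate_subset_openHoughTemplate {r r' : ℝ} (hr : 0 ≤ r) (h : r < r')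
    (θ : ℝ × ℝ) : houghTemplate r θ ⊆ openHoughTemplate r' θ := by
  intro p hp
  rw [mem_houghTemplate_iff hr] at hp
  exact hp.trans_lt (mul_lt_mul_of_pos_right h (by positivity))

theorem openHoughTemplate_mono {r r' : ℝ} (h : r ≤ r') (θ : ℝ × ℝ) :
    openHoughTemplate r θ ⊆ openHoughTemplate r' θ := fun _ hp =>
  lt_of_lt_of_le hp (mul_le_mul_of_nonneg_right h (by positivity))

/-! ### Symmetric strictly unimodal densities -/

/-- The integral over a centred window strictly exceeds the integral over a shifted one. -/
theorem integral_shifted_window_lt {f : ℝ → ℝ} (hint : ∀ a b, IntervalIntegrable f volume a b)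
    (hsymm : ∀ x, f x = f (-x)) (hanti : StrictAntiOn f (Set.Ici 0)) {s t : ℝ}
    (hs : 0 < s) (ht : 0 < t) :
    ∫ x in (t - s)..(t + s), f x < ∫ x in (-s)..s, f x := by
  have habs : ∀ x, f x = f |x| := fun x => by
    rcases abs_choice x with h | h <;> rw [h]
    exact hsymm x
  -- Signed integrals turn the difference of the windows into the mass near the left ends minus the
  -- mass near the right ends, whether or not the windows overlap. Pointwise, `|w - s| < w + s` then
  -- decides.
  have h1 := intervalIntegral.integral_interval_sub_interval_comm
    (hint (-s) s) (hint (t - s) (t + s)) (hint (-s) (t - s))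
  have h2 : ∫ x in (-s)..(t - s), f x = ∫ w in (0 : ℝ)..t, f (w - s) := by
    rw [intervalIntegral.integral_comp_sub_right]; simp
  have h3 : ∫ x in s..(t + s), f x = ∫ w in (0 : ℝ)..t, f (w + s) := by
    rw [intervalIntegral.integral_comp_add_right]; simp
  have i2 : IntervalIntegrable (fun w => f (w - s)) volume 0 t := by
    simpa using (hint (-s) (t - s)).comp_sub_right s
  have i3 : IntervalIntegrable (fun w => f (w + s)) volume 0 t := by
    simpa using (hint s (t + s)).comp_add_right s
  have h4 : 0 < ∫ w in (0 : ℝ)..t, (f (w - s) - f (w + s)) := by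
    refine intervalIntegral.intervalIntegral_pos_of_pos_on (i2.sub i3) (fun w hw => ?_) ht
    rw [sub_pos, habs (w - s)]
    refine hanti (Set.mem_Ici.2 (abs_nonneg _)) (Set.mem_Ici.2 (by linarith [hw.1])) ?_
    rw [abs_lt]
    constructor <;> linarith [hw.1]
  rw [intervalIntegral.integral_sub i2 i3] at h4
  linarith

theorem integral_window_neg {f : ℝ → ℝ} (hsymm : ∀ x, f x = f (-x)) (s t : ℝ) :
    ∫ x in (-t - s)..(-t + s), f x = ∫ x in (t - s)..(t + s), f x := by
  have h := intervalIntegral.integral_comp_neg (a := t - s) (b := t + s) f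
  rw [show -(t + s) = -t - s by ring, show -(t - s) = -t + s by ring] at h
  rw [← h]
  exact intervalIntegral.integral_congr fun x _ => (hsymm x).symm

theorem withDensity_Icc_eq {f : ℝ → ℝ} (hint : ∀ a b, IntervalIntegrable f volume a b)
    (hnn : ∀ x, 0 ≤ f x) {a b : ℝ} (hab : a ≤ b) :
    (volume : Measure ℝ).withDensity (fun x => ENNReal.ofReal (f x)) (Set.Icc a b)
      = ENNReal.ofReal (∫ x in a..b, f x) := by
  rw [withDensity_apply _ measurableSet_Icc, intervalIntegral.integral_of_le hab,
    ← integral_Icc_eq_integral_Ioc,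
    ofReal_integral_eq_lintegral_ofReal _ (ae_of_all _ hnn)]
  exact (intervalIntegrable_iff_integrableOn_Icc_of_le hab).1 (hint a b)

theorem intervalIntegrable_of_measurable_of_bounded {f : ℝ → ℝ} (hf : Measurable f)
    (hnn : ∀ x, 0 ≤ f x) {C : ℝ} (hC : ∀ x, f x ≤ C) (a b : ℝ) :
    IntervalIntegrable f volume a b := by
  refine (intervalIntegrable_const (c := C)).mono_fun hf.aestronglyMeasurable
    (ae_of_all _ fun x => ?_)
  beta_reduce
  rw [Real.norm_of_nonneg (hnn x)]
  exact (hC x).trans (le_abs_self C)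

/-- A symmetric strictly unimodal law gives a centred window more mass than any shifted one. -/
theorem withDensity_shifted_window_lt {f : ℝ → ℝ} (hf : Measurable f) (hnn : ∀ x, 0 ≤ f x)
    {C : ℝ} (hC : ∀ x, f x ≤ C) (hsymm : ∀ x, f x = f (-x)) (hanti : StrictAntiOn f (Set.Ici 0))
    {s t : ℝ} (hs : 0 < s) (ht : t ≠ 0) :
    (volume : Measure ℝ).withDensity (fun x => ENNReal.ofReal (f x)) {e | |t - e| ≤ s}
      < (volume : Measure ℝ).withDensity (fun x => ENNReal.ofReal (f x)) {e | |e| ≤ s} := by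
  have hint := intervalIntegrable_of_measurable_of_bounded hf hnn hC
  have e1 : {e | |t - e| ≤ s} = Set.Icc (t - s) (t + s) := by
    ext e; simp only [Set.mem_ofPred_eq, abs_le, Set.mem_Icc]
    constructor <;> rintro ⟨h, h'⟩ <;> constructor <;> linarith
  have e2 : {e | |e| ≤ s} = Set.Icc (-s) s := by
    ext e; simp only [Set.mem_ofPred_eq, abs_le, Set.mem_Icc]
  rw [e1, e2, withDensity_Icc_eq hint hnn (by linarith), withDensity_Icc_eq hint hnn (by linarith)]
  have key : ∫ x in (t - s)..(t + s), f x < ∫ x in (-s)..s, f x := by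
    rcases lt_or_gt_of_ne ht with h | h
    · rw [← integral_window_neg hsymm s t]
      exact integral_shifted_window_lt hint hsymm hanti hs (neg_pos.2 h)
    · exact integral_shifted_window_lt hint hsymm hanti hs h
  refine (ENNReal.ofReal_lt_ofReal_iff (lt_of_le_of_lt ?_ key)).2 key
  exact intervalIntegral.integral_nonneg (by linarith) fun x _ => hnn x

/-! ### Empirical frequencies -/

/-- Almost surely, for all large samples every parameter in `U` is beaten by `θ₀`. -/
def IsHoughDominated {Ω : Type*} [MeasurableSpace Ω] (P : Measure Ω) (Z : ℕ → Ω → ℝ × ℝ) (r : ℝ) (θ₀ : ℝ × ℝ)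
    (U : Set (ℝ × ℝ)) : Prop :=
  ∀ᵐ ω ∂P, ∀ᶠ n in atTop, ∀ θ ∈ U,
    houghObjective r n (fun i => Z i ω) θ < houghObjective r n (fun i => Z i ω) θ₀

/-- With `IsHoughDominated.union`, this makes the dominated sets an ideal, which is what the
ultrafilter argument needs. -/
theorem IsHoughDominated.mono {Ω : Type*} [MeasurableSpace Ω] {P : Measure Ω}
    {Z : ℕ → Ω → ℝ × ℝ} {r : ℝ} {θ₀ : ℝ × ℝ} {U V : Set (ℝ × ℝ)}
    (hV : IsHoughDominated P Z r θ₀ V) (h : U ⊆ V) : IsHoughDominated P Z r θ₀ U := by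
  filter_upwards [hV] with ω hω
  filter_upwards [hω] with n hn θ hθ using hn θ (h hθ)

theorem IsHoughDominated.union {Ω : Type*} [MeasurableSpace Ω] {P : Measure Ω}
    {Z : ℕ → Ω → ℝ × ℝ} {r : ℝ} {θ₀ : ℝ × ℝ} {U V : Set (ℝ × ℝ)}
    (hU : IsHoughDominated P Z r θ₀ U) (hV : IsHoughDominated P Z r θ₀ V) :
    IsHoughDominated P Z r θ₀ (U ∪ V) := by
  filter_upwards [hU, hV] with ω h1 h2
  filter_upwards [h1, h2] with n h1 h2 θ hθ using hθ.elim (h1 θ) (h2 θ)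

section Empirical

variable {Ω : Type*} [MeasurableSpace Ω] {P : Measure Ω} [IsProbabilityMeasure P]
  {Z : ℕ → Ω → ℝ × ℝ}

theorem tendsto_empirical_frequency (hZ : ∀ i, Measurable (Z i)) (hindep : iIndepFun Z P)
    (hident : ∀ i, IdentDistrib (Z i) (Z 0) P P) {W : Set (ℝ × ℝ)} (hW : MeasurableSet W) :
    ∀ᵐ ω ∂P, Tendsto (fun n : ℕ => (1 / (n : ℝ)) *
      ∑ i ∈ Finset.range n, W.indicator (fun _ => (1 : ℝ)) (Z i ω)) atTop
        (𝓝 ((P.map (Z 0)).real W)) := by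
  have hg : Measurable (W.indicator (fun _ => (1 : ℝ))) := measurable_const.indicator hW
  have h := strong_law_ae_real (μ := P) (fun i ω => W.indicator (fun _ => (1 : ℝ)) (Z i ω))
    (Integrable.of_bound (C := 1) (hg.comp (hZ 0)).aestronglyMeasurable
      (ae_of_all _ fun ω => by
        by_cases h : Z 0 ω ∈ W <;> simp [h]))
    (fun i j hij => (hindep.indepFun hij).comp hg hg)
    (fun i => (hident i).comp hg)
  have hI : P[fun ω => W.indicator (fun _ => (1 : ℝ)) (Z 0 ω)] = (P.map (Z 0)).real W := by
    rw [← integral_map (hZ 0).aemeasurable hg.aestronglyMeasurable, integral_indicator_const _ hW]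
    simp
  rw [hI] at h
  filter_upwards [h] with ω hω
  refine hω.congr fun n => ?_
  rw [div_eq_mul_inv, mul_comm, one_div]

/-- The frequency of `W` bounds the objective on all of `U` at once, so the strong law for just two
sets replaces a uniform law over parameters. -/
theorem isHoughDominated_of_envelope (hZ : ∀ i, Measurable (Z i)) (hindep : iIndepFun Z P)
    (hident : ∀ i, IdentDistrib (Z i) (Z 0) P P) {r : ℝ} {θ₀ : ℝ × ℝ} {U W : Set (ℝ × ℝ)}
    (hW : MeasurableSet W) (hUW : ∀ θ ∈ U, houghTemplate r θ ⊆ W)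
    (hlt : P.map (Z 0) W < P.map (Z 0) (houghTemplate r θ₀)) :
    IsHoughDominated P Z r θ₀ U := by
  have : IsProbabilityMeasure (P.map (Z 0)) :=
    Measure.isProbabilityMeasure_map (hZ 0).aemeasurable
  have hlt' : (P.map (Z 0)).real W < (P.map (Z 0)).real (houghTemplate r θ₀) :=
    (ENNReal.toReal_lt_toReal (measure_ne_top _ _) (measure_ne_top _ _)).2 hlt
  filter_upwards [tendsto_empirical_frequency hZ hindep hident hW,
    tendsto_empirical_frequency hZ hindep hident (measurableSet_houghTemplate r θ₀)] with ω h1 h2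
  filter_upwards [h1.eventually_lt h2 hlt'] with n hn θ hθ
  refine lt_of_le_of_lt ?_ hn
  refine mul_le_mul_of_nonneg_left (Finset.sum_le_sum fun i _ => ?_) (by positivity)
  exact Set.indicator_le_indicator_of_subset (hUW θ hθ) (fun _ => zero_le_one) _

/-- If the points lying in slightly enlarged templates with parameters from every `U k` form a
set of smaller probability than the template of `θ₀`, then some `U k` is dominated. -/
theorem exists_isHoughDominated (hZ : ∀ i, Measurable (Z i)) (hindep : iIndepFun Z P)
    (hident : ∀ i, IdentDistrib (Z i) (Z 0) P P) {r : ℝ} (hr : 0 < r) {θ₀ : ℝ × ℝ}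
    {U : ℕ → Set (ℝ × ℝ)} (hU : Antitone U) {B : Set (ℝ × ℝ)}
    (hB : P.map (Z 0) B < P.map (Z 0) (houghTemplate r θ₀))
    (hUB : ∀ (p : ℝ × ℝ) (θ : ℕ → ℝ × ℝ), (∀ k, θ k ∈ U k) →
      (∀ k : ℕ, p ∈ openHoughTemplate (r * (1 + 1 / ((k : ℝ) + 1))) (θ k)) → p ∈ B) :
    ∃ k, IsHoughDominated P Z r θ₀ (U k) := by
  have : IsProbabilityMeasure (P.map (Z 0)) :=
    Measure.isProbabilityMeasure_map (hZ 0).aemeasurable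
  set V : ℕ → Set (ℝ × ℝ) := fun k =>
    ⋃ θ ∈ U k, openHoughTemplate (r * (1 + 1 / ((k : ℝ) + 1))) θ with hV
  -- The union is uncountable; open templates of slightly larger radius are used so that it is open,
  -- hence measurable.
  have hVm : ∀ k, MeasurableSet (V k) := fun k =>
    (isOpen_biUnion fun θ _ => isOpen_openHoughTemplate _ θ).measurableSet
  have hVanti : Antitone V := by
    intro j k hjk
    refine Set.biUnion_mono (hU hjk) fun θ _ => openHoughTemplate_mono ?_ θ
    gcongr
  have hsub : ⋂ k, V k ⊆ B := by
    intro p hp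
    have h : ∀ k : ℕ, ∃ θ ∈ U k, p ∈ openHoughTemplate (r * (1 + 1 / ((k : ℝ) + 1))) θ :=
      fun k => by simpa [hV] using Set.mem_iInter.1 hp k
    choose θ h1 h2 using h
    exact hUB p θ h1 h2
  have hlim := tendsto_measure_iInter_atTop (μ := P.map (Z 0))
    (fun k => (hVm k).nullMeasurableSet) hVanti ⟨0, measure_ne_top _ _⟩
  obtain ⟨k, hk⟩ := (hlim.eventually_lt_const ((measure_mono hsub).trans_lt hB)).exists
  refine ⟨k, isHoughDominated_of_envelope hZ hindep hident (hVm k) (fun θ hθ => ?_) hk⟩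
  refine (houghTemplate_subset_openHoughTemplate hr.le ?_ θ).trans
    (Set.subset_biUnion_of_mem (u := fun θ => openHoughTemplate _ θ) hθ)
  have : (0 : ℝ) < 1 / ((k : ℝ) + 1) := by positivity
  nlinarith

end Empirical
-- From domination to convergence
/-- If almost surely every complement of a ball around `θ₀` is dominated, maximizers converge. -/
theorem tendsto_of_isHoughDominated {Ω : Type*} [MeasurableSpace Ω] {P : Measure Ω}
    {Z : ℕ → Ω → ℝ × ℝ} {r : ℝ} {θ₀ : ℝ × ℝ}
    (h : ∀ δ > 0, IsHoughDominated P Z r θ₀ {θ | δ ≤ dist θ θ₀}) {θhat : ℕ → Ω → ℝ × ℝ}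
    (hθ : ∀ n, ∀ᵐ ω ∂P, IsHoughEstimate r n (fun i => Z i ω) (θhat n ω)) :
    ∀ᵐ ω ∂P, Tendsto (fun n => θhat n ω) atTop (𝓝 θ₀) := by
  have h' : ∀ᵐ ω ∂P, ∀ m : ℕ, ∀ᶠ n in atTop, ∀ θ ∈ {θ | 1 / ((m : ℝ) + 1) ≤ dist θ θ₀},
      houghObjective r n (fun i => Z i ω) θ < houghObjective r n (fun i => Z i ω) θ₀ :=
    ae_all_iff.2 fun m => h _ (by positivity)
  filter_upwards [h', ae_all_iff.2 hθ] with ω h1 h2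
  rw [Metric.tendsto_nhds]
  intro δ hδ
  obtain ⟨m, hm⟩ := exists_nat_one_div_lt hδ
  filter_upwards [h1 m] with n hn
  by_contra! hd
  exact absurd (h2 n θ₀) (not_le.2 (hn _ (hm.le.trans hd)))

/-! ### Probabilities under the linear model -/

/-- The law of `(X, a₀ X + b₀ + ε)` evaluated through its sections. -/
theorem map_linear_model_apply {Ω : Type*} [MeasurableSpace Ω] {P : Measure Ω}
    [IsProbabilityMeasure P] {X ε : Ω → ℝ} (hX : Measurable X) (hε : Measurable ε)
    (hind : IndepFun X ε P) (a₀ b₀ : ℝ) {B : Set (ℝ × ℝ)} (hB : MeasurableSet B) :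
    P.map (fun ω => (X ω, a₀ * X ω + b₀ + ε ω)) B
      = ∫⁻ x, P.map ε {e | (x, a₀ * x + b₀ + e) ∈ B} ∂(P.map X) := by
  have : IsProbabilityMeasure (P.map ε) := Measure.isProbabilityMeasure_map hε.aemeasurable
  have : IsProbabilityMeasure (P.map X) := Measure.isProbabilityMeasure_map hX.aemeasurable
  have hg : Measurable (fun p : ℝ × ℝ => (p.1, a₀ * p.1 + b₀ + p.2)) := by fun_prop
  have hprod := (indepFun_iff_map_prod_eq_prod_map_map hX.aemeasurable hε.aemeasurable).1 hind
  have hcomp : (fun ω => (X ω, a₀ * X ω + b₀ + ε ω))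
      = (fun p : ℝ × ℝ => (p.1, a₀ * p.1 + b₀ + p.2)) ∘ fun ω => (X ω, ε ω) := rfl
  rw [hcomp, ← Measure.map_map hg (hX.prodMk hε), hprod, Measure.map_apply hg hB,
    Measure.prod_apply (hg hB)]
  rfl

/-- Comparison of a set with the template of the true parameter, section by section. -/
theorem map_linear_model_lt {Ω : Type*} [MeasurableSpace Ω] {P : Measure Ω}
    [IsProbabilityMeasure P] {X ε : Ω → ℝ} (hX : Measurable X) (hε : Measurable ε)
    (hind : IndepFun X ε P) (a₀ b₀ : ℝ) (hnondeg : ¬ ∃ c : ℝ, ∀ᵐ ω ∂P, X ω = c)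
    {r : ℝ} (hr : 0 ≤ r) {B : Set (ℝ × ℝ)} (hB : MeasurableSet B) (c : ℝ)
    (hle : ∀ x, P.map ε {e | (x, a₀ * x + b₀ + e) ∈ B}
      ≤ P.map ε {e | |e| ≤ r * √(x ^ 2 + 1)})
    (hlt : ∀ x, x ≠ c → P.map ε {e | (x, a₀ * x + b₀ + e) ∈ B}
      < P.map ε {e | |e| ≤ r * √(x ^ 2 + 1)}) :
    P.map (fun ω => (X ω, a₀ * X ω + b₀ + ε ω)) B
      < P.map (fun ω => (X ω, a₀ * X ω + b₀ + ε ω)) (houghTemplate r (a₀, b₀)) := by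
  have hT := measurableSet_houghTemplate r (a₀, b₀)
  have : IsProbabilityMeasure (P.map ε) := Measure.isProbabilityMeasure_map hε.aemeasurable
  have hg : Measurable (fun p : ℝ × ℝ => (p.1, a₀ * p.1 + b₀ + p.2)) := by fun_prop
  have hsec : ∀ x, {e | (x, a₀ * x + b₀ + e) ∈ houghTemplate r (a₀, b₀)}
      = {e | |e| ≤ r * √(x ^ 2 + 1)} := fun x => by
    ext e
    simp only [mem_houghTemplate_iff hr, Set.mem_ofPred_eq]
    rw [show x * a₀ + b₀ - (a₀ * x + b₀ + e) = -e by ring, abs_neg]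
  rw [map_linear_model_apply hX hε hind a₀ b₀ hB, map_linear_model_apply hX hε hind a₀ b₀ hT]
  refine lintegral_strict_mono_of_ae_le_of_ae_lt_on (s := {c}ᶜ) ?_ ?_ ?_ ?_ ?_
  · exact (measurable_measure_prodMk_left (ν := P.map ε) (hg hT)).aemeasurable
  · rw [← map_linear_model_apply hX hε hind a₀ b₀ hB]
    exact ((measure_mono (Set.subset_univ _)).trans_lt (by
      rw [Measure.map_apply (by fun_prop) MeasurableSet.univ]
      exact measure_lt_top _ _)).ne
  · exact ae_of_all _ fun x => (hle x).trans_eq (by beta_reduce; rw [hsec])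
  -- If `{c}ᶜ` were null, `X` would be almost surely equal to `c`.
  · intro h0
    rw [Measure.map_apply hX (measurableSet_singleton c).compl] at h0
    exact hnondeg ⟨c, h0⟩
  · exact ae_of_all _ fun x hx => (hlt x hx).trans_eq (by rw [hsec])

/-! ### Compactness along ultrafilters -/

/-- A set of parameters that is not dominated carries an ultrafilter without dominated sets. -/
theorem exists_ultrafilter_not_isHoughDominated {Ω : Type*} [MeasurableSpace Ω] {P : Measure Ω}
    {Z : ℕ → Ω → ℝ × ℝ} {r : ℝ} {θ₀ : ℝ × ℝ} {S : Set (ℝ × ℝ)}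
    (hS : ¬ IsHoughDominated P Z r θ₀ S) :
    ∃ F : Ultrafilter (ℝ × ℝ), S ∈ F ∧ ∀ U ∈ F, ¬ IsHoughDominated P Z r θ₀ U := by
  -- The filter dual to the ideal of dominated sets; an ultrafilter finer than `L ⊓ 𝓟 S` can contain
  -- no dominated set.
  let L : Filter (ℝ × ℝ) := comk (IsHoughDominated P Z r θ₀)
    (ae_of_all _ fun ω => Eventually.of_forall fun n θ hθ => hθ.elim)
    (fun t ht s hst => ht.mono hst) (fun s hs t ht => hs.union ht)
  have hL : ∀ {s}, s ∈ L ↔ IsHoughDominated P Z r θ₀ sᶜ := mem_comk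
  have : (L ⊓ 𝓟 S).NeBot := by
    refine ⟨fun h => hS ?_⟩
    have h' : Sᶜ ∈ L := mem_iff_inf_principal_compl.2 (by rwa [compl_compl])
    rwa [hL, compl_compl] at h'
  refine ⟨Ultrafilter.of (L ⊓ 𝓟 S), ?_, fun U hU hd => ?_⟩
  · exact (Ultrafilter.of_le _).trans inf_le_right (mem_principal_self S)
  · have hUL : Uᶜ ∈ L := by rwa [hL, compl_compl]
    have : Uᶜ ∈ Ultrafilter.of (L ⊓ 𝓟 S) := (Ultrafilter.of_le _).trans inf_le_left hUL
    exact Ultrafilter.compl_mem_iff_notMem.1 this hU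

/-- A bounded function converges along an ultrafilter. -/
theorem Ultrafilter.exists_tendsto_of_norm_le {α E : Type*} [NormedAddCommGroup E] [ProperSpace E]
    (F : Ultrafilter α) {g : α → E} {R : ℝ} (h : {x | ‖g x‖ ≤ R} ∈ F) :
    ∃ y, Tendsto g F (𝓝 y) := by
  obtain ⟨y, -, hy⟩ := (isCompact_closedBall (0 : E) R).ultrafilter_le_nhds (F.map g)
    (by
      rw [le_principal_iff]
      exact mem_of_superset h fun x hx => mem_closedBall_zero_iff.2 hx)
  exact ⟨y, hy⟩

/-- An unbounded sequence of lines `(a, b)` with limiting direction `u` that stays close to a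
point of the plane is vertical in the limit. -/
theorem direction_eq_zero_of_bounded {θ : ℕ → ℝ × ℝ} {u : ℝ × ℝ} {x R : ℝ}
    (hθ : Tendsto (fun k => ‖θ k‖) atTop atTop)
    (hu : Tendsto (fun k => ‖θ k‖⁻¹ • θ k) atTop (𝓝 u))
    (hb : ∀ k, |x * (θ k).1 + (θ k).2| ≤ R) : x * u.1 + u.2 = 0 := by
  have h1 : Tendsto (fun k => x * (‖θ k‖⁻¹ • θ k).1 + (‖θ k‖⁻¹ • θ k).2) atTop
      (𝓝 (x * u.1 + u.2)) := by
    have hc : Continuous fun p : ℝ × ℝ => x * p.1 + p.2 := by fun_prop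
    exact (hc.tendsto u).comp hu
  have h2 : Tendsto (fun k => ‖θ k‖⁻¹ * R) atTop (𝓝 0) := by
    simpa using (tendsto_inv_atTop_zero.comp hθ).mul_const R
  refine tendsto_nhds_unique h1 (squeeze_zero_norm (fun k => ?_) h2)
  have : x * (‖θ k‖⁻¹ • θ k).1 + (‖θ k‖⁻¹ • θ k).2 = ‖θ k‖⁻¹ * (x * (θ k).1 + (θ k).2) := by
    simp only [Prod.smul_fst, Prod.smul_snd, smul_eq_mul]; ring
  rw [this, norm_mul, norm_inv, norm_norm, Real.norm_eq_abs]
  exact mul_le_mul_of_nonneg_left (hb k) (by positivity)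

theorem tendsto_of_dist_lt_one_div {E : Type*} [PseudoMetricSpace E] {v : ℕ → E} {y : E}
    (h : ∀ k : ℕ, dist (v k) y < 1 / ((k : ℝ) + 1)) : Tendsto v atTop (𝓝 y) :=
  tendsto_iff_dist_tendsto_zero.2 <| squeeze_zero (fun _ => dist_nonneg) (fun k => (h k).le)
    tendsto_one_div_add_atTop_nhds_zero_nat

/-- The inflation factors tend to 1, so the limit recovers the closed window of radius exactly `r`.
-/
theorem abs_sub_le_of_tendsto_of_mem_openHoughTemplate {r : ℝ} {p : ℝ × ℝ} {θ : ℕ → ℝ × ℝ} {t : ℝ}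
    (hp : ∀ k : ℕ, p ∈ openHoughTemplate (r * (1 + 1 / ((k : ℝ) + 1))) (θ k))
    (ht : Tendsto (fun k => p.1 * (θ k).1 + (θ k).2) atTop (𝓝 t)) :
    |t - p.2| ≤ r * √(p.1 ^ 2 + 1) := by
  have h2 : Tendsto (fun k : ℕ => r * (1 + 1 / ((k : ℝ) + 1)) * √(p.1 ^ 2 + 1)) atTop
      (𝓝 (r * √(p.1 ^ 2 + 1))) := by
    simpa using ((tendsto_one_div_add_atTop_nhds_zero_nat.const_add 1).const_mul r).mul_const
      (√(p.1 ^ 2 + 1))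
  exact le_of_tendsto_of_tendsto' (ht.sub_const p.2).abs h2 fun k => (hp k).le

theorem abs_le_of_mem_openHoughTemplate {r : ℝ} (hr : 0 ≤ r) {p θ : ℝ × ℝ} {k : ℕ}
    (hp : p ∈ openHoughTemplate (r * (1 + 1 / ((k : ℝ) + 1))) θ) :
    |p.1 * θ.1 + θ.2| ≤ |p.2| + r * 2 * √(p.1 ^ 2 + 1) := by
  have h1 : 1 / ((k : ℝ) + 1) ≤ 1 := by
    rw [div_le_one (by positivity)]; linarith [Nat.cast_nonneg (α := ℝ) k]
  have h2 := openHoughTemplate_mono (r' := r * 2)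
    (mul_le_mul_of_nonneg_left (by linarith) hr) θ hp
  have h3 := abs_sub_abs_le_abs_sub (p.1 * θ.1 + θ.2) p.2
  have h4 : |p.1 * θ.1 + θ.2 - p.2| < r * 2 * √(p.1 ^ 2 + 1) := h2
  linarith

/-- Every set of parameters bounded away from `θ₀` is dominated, provided `θ₀` strictly
maximizes the probability of the template and the template of `θ₀` is more likely than the part
of any vertical line that a template can contain. -/
theorem isHoughDominated_of_le_dist {Ω : Type*} [MeasurableSpace Ω] {P : Measure Ω}
    [IsProbabilityMeasure P] {Z : ℕ → Ω → ℝ × ℝ} (hZ : ∀ i, Measurable (Z i))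
    (hindep : iIndepFun Z P) (hident : ∀ i, IdentDistrib (Z i) (Z 0) P P) {r : ℝ} (hr : 0 < r)
    {θ₀ : ℝ × ℝ}
    (hmax : ∀ θ, θ ≠ θ₀ → P.map (Z 0) (houghTemplate r θ) < P.map (Z 0) (houghTemplate r θ₀))
    (hline : ∀ c t : ℝ, P.map (Z 0) {p | p.1 = c ∧ |t - p.2| ≤ r * √(p.1 ^ 2 + 1)}
      < P.map (Z 0) (houghTemplate r θ₀)) {δ : ℝ} (hδ : 0 < δ) :
    IsHoughDominated P Z r θ₀ {θ | δ ≤ dist θ θ₀} := by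
  by_contra hS
  obtain ⟨F, hSF, hF⟩ := exists_ultrafilter_not_isHoughDominated hS
  have hsmall : ∀ {E : Type} [PseudoMetricSpace E] {g : ℝ × ℝ → E} {y : E},
      Tendsto g F (𝓝 y) → ∀ k : ℕ, {θ | dist (g θ) y < 1 / ((k : ℝ) + 1)} ∈ F :=
    fun h k => Metric.tendsto_nhds.1 h _ (by positivity)
  have hbound : ∀ {j k : ℕ}, j ≤ k → 1 / ((k : ℝ) + 1) ≤ 1 / ((j : ℝ) + 1) := fun h =>
    Nat.one_div_le_one_div h
  -- Bounded along `F`: the parameter converges to some `θ'`, and the enlarged templates shrink into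
  -- that of `θ'`. Otherwise its norm tends to infinity along `F`.
  by_cases hbdd : ∃ R : ℝ, {θ : ℝ × ℝ | ‖θ‖ ≤ R} ∈ F
  · obtain ⟨R, hR⟩ := hbdd
    obtain ⟨θ', hθ'⟩ := F.exists_tendsto_of_norm_le (g := fun θ => θ) hR
    have hne : θ' ≠ θ₀ := by
      rintro rfl
      have h1 := Metric.tendsto_nhds.1 hθ' δ hδ
      obtain ⟨θ, h2, h3⟩ := (h1.and hSF).exists
      exact absurd h3 (not_le.2 h2)
    obtain ⟨k, hk⟩ := exists_isHoughDominated hZ hindep hident hr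
      (U := fun k : ℕ => {θ | dist θ θ' < 1 / ((k : ℝ) + 1)})
      (fun j k hjk θ hθ => lt_of_lt_of_le hθ (hbound hjk)) (hmax θ' hne)
      (fun p θ hθ hp => by
        rw [mem_houghTemplate_iff hr.le]
        refine abs_sub_le_of_tendsto_of_mem_openHoughTemplate hp ?_
        have hc : Continuous fun q : ℝ × ℝ => p.1 * q.1 + q.2 := by fun_prop
        exact (hc.tendsto θ').comp (tendsto_of_dist_lt_one_div hθ))
    exact hF _ (hsmall hθ' k) hk
  · have hlarge : ∀ k : ℕ, {θ : ℝ × ℝ | (k : ℝ) < ‖θ‖} ∈ F := fun k => by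
      have := Ultrafilter.compl_mem_iff_notMem.2 fun h => hbdd ⟨k, h⟩
      filter_upwards [this] with θ hθ
      simpa using hθ
    obtain ⟨u, hu⟩ := F.exists_tendsto_of_norm_le (g := fun θ : ℝ × ℝ => ‖θ‖⁻¹ • θ) (R := 1)
      (univ_mem' fun θ => by
        change ‖‖θ‖⁻¹ • θ‖ ≤ 1
        rw [norm_smul, norm_inv, norm_norm]
        exact inv_mul_le_one)
    have hu1 : ‖u‖ = 1 := by
      refine tendsto_nhds_unique hu.norm (tendsto_const_nhds.congr' ?_)
      filter_upwards [hlarge 0] with θ hθ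
      rw [norm_smul, norm_inv, norm_norm, inv_mul_cancel₀]
      exact (lt_of_le_of_lt (by simp) hθ).ne'
    have hvert : ∀ (p : ℝ × ℝ) (θ : ℕ → ℝ × ℝ), (∀ k : ℕ, (k : ℝ) < ‖θ k‖) →
        (∀ k : ℕ, dist (‖θ k‖⁻¹ • θ k) u < 1 / ((k : ℝ) + 1)) →
        (∀ k : ℕ, p ∈ openHoughTemplate (r * (1 + 1 / ((k : ℝ) + 1))) (θ k)) →
        p.1 = -u.2 / u.1 := by
      intro p θ h1 h2 hp
      have h0 := direction_eq_zero_of_bounded (x := p.1)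
        (tendsto_atTop_mono (fun k => (h1 k).le) tendsto_natCast_atTop_atTop)
        (tendsto_of_dist_lt_one_div h2)
        (fun k => abs_le_of_mem_openHoughTemplate hr.le (hp k))
      have hne : u.1 ≠ 0 := by
        intro h
        have h' : u = 0 := Prod.ext h (by simpa [h] using h0)
        simp [h'] at hu1
      rw [eq_div_iff hne]; linarith
    -- If `u.1 = 0`, this is the default value 0, and `hvert` holds because no point can satisfy its
    -- hypotheses.
    set c : ℝ := -u.2 / u.1
    -- The height of the line at abscissa `c` either converges, leaving a vertical segment, or
    -- escapes, leaving nothing.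
    by_cases hcb : ∃ R : ℝ, {θ : ℝ × ℝ | ‖c * θ.1 + θ.2‖ ≤ R} ∈ F
    · obtain ⟨R, hR⟩ := hcb
      obtain ⟨t, ht⟩ := F.exists_tendsto_of_norm_le hR
      obtain ⟨k, hk⟩ := exists_isHoughDominated hZ hindep hident hr
        (U := fun k : ℕ => {θ | (k : ℝ) < ‖θ‖ ∧ dist (‖θ‖⁻¹ • θ) u < 1 / ((k : ℝ) + 1) ∧
          dist (c * θ.1 + θ.2) t < 1 / ((k : ℝ) + 1)})
        (fun j k hjk θ hθ => ⟨lt_of_le_of_lt (by exact_mod_cast hjk) hθ.1,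
          hθ.2.1.trans_le (hbound hjk), hθ.2.2.trans_le (hbound hjk)⟩) (hline c t)
        (fun p θ hθ hp => by
          have h := hvert p θ (fun k => (hθ k).1) (fun k => (hθ k).2.1) hp
          refine ⟨h, abs_sub_le_of_tendsto_of_mem_openHoughTemplate hp ?_⟩
          rw [h]
          exact tendsto_of_dist_lt_one_div fun k => (hθ k).2.2)
      exact hF _ (inter_mem (hlarge k) (inter_mem (hsmall hu k) (hsmall ht k))) hk
    · have hclarge : ∀ k : ℕ, {θ : ℝ × ℝ | (k : ℝ) < ‖c * θ.1 + θ.2‖} ∈ F := fun k => by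
        have := Ultrafilter.compl_mem_iff_notMem.2 fun h => hcb ⟨k, h⟩
        filter_upwards [this] with θ hθ
        simpa using hθ
      obtain ⟨k, hk⟩ := exists_isHoughDominated hZ hindep hident hr
        (U := fun k : ℕ => {θ | (k : ℝ) < ‖θ‖ ∧ dist (‖θ‖⁻¹ • θ) u < 1 / ((k : ℝ) + 1) ∧
          (k : ℝ) < ‖c * θ.1 + θ.2‖})
        (fun j k hjk θ hθ => ⟨lt_of_le_of_lt (by exact_mod_cast hjk) hθ.1,
          hθ.2.1.trans_le (hbound hjk), lt_of_le_of_lt (by exact_mod_cast hjk) hθ.2.2⟩)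
        -- Any instance of `hline` would do: it only serves to make the mass of the true template
        -- positive.
        (B := ∅) (lt_of_le_of_lt (by simp) (hline 0 0))
        (fun p θ hθ hp => by
          have h := hvert p θ (fun k => (hθ k).1) (fun k => (hθ k).2.1) hp
          obtain ⟨k, hk⟩ := exists_nat_gt (|p.2| + r * 2 * √(p.1 ^ 2 + 1))
          have h1 := (hθ k).2.2
          rw [← h, Real.norm_eq_abs] at h1
          linarith [abs_le_of_mem_openHoughTemplate hr.le (hp k)])
      exact hF _ (inter_mem (hlarge k) (inter_mem (hsmall hu k) (hclarge k))) hk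

/-! ### Consistency of the estimator -/

theorem theorem1 {Ω : Type*} [MeasurableSpace Ω] (P : Measure Ω) [IsProbabilityMeasure P]
    (X Y ε : ℕ → Ω → ℝ) (a₀ b₀ : ℝ) (f : ℝ → ℝ)
    -- the observations are i.i.d. and follow the linear model
    (hX : ∀ i, Measurable (X i)) (hε : ∀ i, Measurable (ε i))
    (hmodel : ∀ i ω, Y i ω = a₀ * X i ω + b₀ + ε i ω)
    (hindep : iIndepFun (fun i ω => (X i ω, Y i ω)) P)
    (hident : ∀ i, IdentDistrib (fun ω => (X i ω, Y i ω)) (fun ω => (X 0 ω, Y 0 ω)) P P)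
    -- the covariate is not almost surely constant
    (hnondeg : ¬ ∃ c : ℝ, ∀ᵐ ω ∂P, X 0 ω = c)
    -- the covariate and the noise are independent
    (hXε : ∀ i, IndepFun (X i) (ε i) P)
    -- the noise has a bounded, symmetric, strictly unimodal density
    (hf : ∀ i, IsDensityOf P (ε i) f)
    (hbdd : ∃ C : ℝ, ∀ x, f x ≤ C)
    (hsymm : ∀ x, f x = f (-x))
    (hunim : StrictlyUnimodal f)
    (r : ℝ) (hr : 0 < r)
    -- any choice of the estimator among the maximizers of the objective function
    (θhat : ℕ → Ω → ℝ × ℝ)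
    (hθ : ∀ n, ∀ᵐ ω ∂P, IsHoughEstimate r n (fun i => (X i ω, Y i ω)) (θhat n ω)) :
    ∀ᵐ ω ∂P, Tendsto (fun n => θhat n ω) atTop (𝓝 (a₀, b₀)) := by
  obtain ⟨hfm, hfnn, hflaw⟩ := hf 0
  obtain ⟨C, hC⟩ := hbdd
  have hY : ∀ i, Y i = fun ω => a₀ * X i ω + b₀ + ε i ω := fun i => funext (hmodel i)
  have hZ : ∀ i, Measurable fun ω => (X i ω, Y i ω) := fun i => by
    rw [hY i]
    exact (hX i).prodMk ((((hX i).const_mul a₀).add_const b₀).add (hε i))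
  have hshift : ∀ {s t : ℝ}, 0 < s → t ≠ 0 →
      P.map (ε 0) {e | |t - e| ≤ s} < P.map (ε 0) {e | |e| ≤ s} := fun hs ht => by
    rw [hflaw]
    exact withDensity_shifted_window_lt hfm hfnn hC hsymm hunim.2.2 hs ht
  have hshift_le : ∀ {s t : ℝ}, 0 < s →
      P.map (ε 0) {e | |t - e| ≤ s} ≤ P.map (ε 0) {e | |e| ≤ s} := fun {s t} hs => by
    rcases eq_or_ne t 0 with rfl | ht
    · simp
    · exact (hshift hs ht).le
  have hpos : ∀ {s : ℝ}, 0 < s → 0 < P.map (ε 0) {e | |e| ≤ s} := fun hs =>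
    bot_le.trans_lt (hshift hs one_ne_zero)
  have hradius : ∀ x : ℝ, 0 < r * √(x ^ 2 + 1) := fun x => by positivity
  have hlt := fun {B : Set (ℝ × ℝ)} => map_linear_model_lt (hX 0) (hε 0) (hXε 0) a₀ b₀ hnondeg
    hr.le (B := B)
  simp only [← hmodel 0] at hlt
  refine tendsto_of_isHoughDominated (Z := fun i ω => (X i ω, Y i ω)) (fun δ hδ =>
    isHoughDominated_of_le_dist hZ hindep hident hr (fun θ hθ => ?_) (fun c t => ?_) hδ) hθ
  · have hsec : ∀ x, {e | (x, a₀ * x + b₀ + e) ∈ houghTemplate r θ}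
        = {e | |(x * (θ.1 - a₀) + (θ.2 - b₀)) - e| ≤ r * √(x ^ 2 + 1)} := fun x => by
      ext e
      simp only [mem_houghTemplate_iff hr.le, Set.mem_ofPred_eq]
      rw [show x * θ.1 + θ.2 - (a₀ * x + b₀ + e) = x * (θ.1 - a₀) + (θ.2 - b₀) - e by ring]
    -- The exceptional abscissa is where the two lines cross. For parallel lines the quotient
    -- defaults to 0, and the displacement vanishes nowhere.
    refine hlt (measurableSet_houghTemplate r θ) (-(θ.2 - b₀) / (θ.1 - a₀)) (fun x => ?_)
      (fun x hx => ?_)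
    · rw [hsec]; exact hshift_le (hradius x)
    · rw [hsec]
      refine hshift (hradius x) fun h => ?_
      have hne : θ.1 - a₀ ≠ 0 := fun h1 => hθ <| by
        rw [h1, mul_zero, zero_add] at h
        exact Prod.ext (sub_eq_zero.1 h1) (sub_eq_zero.1 h)
      exact hx (by rw [eq_div_iff hne]; linarith)
  · have hsec : ∀ x, x ≠ c → {e | (x, a₀ * x + b₀ + e) ∈
        {p : ℝ × ℝ | p.1 = c ∧ |t - p.2| ≤ r * √(p.1 ^ 2 + 1)}} = ∅ := fun x hx => by
      ext e; simp [hx]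
    refine hlt ((measurable_fst (measurableSet_singleton c)).inter
      (measurableSet_le (f := fun p : ℝ × ℝ => |t - p.2|) (by fun_prop) (by fun_prop))) c (fun x => ?_) (fun x hx => ?_)
    -- On the line `x = c` the section is at most a displaced window; off it the section is empty
    -- while the centred window has positive mass.
    · refine (measure_mono fun e he => ?_).trans
        (hshift_le (t := t - (a₀ * x + b₀)) (hradius x))
      have h : |t - (a₀ * x + b₀ + e)| ≤ r * √(x ^ 2 + 1) := he.2
      rwa [← sub_sub] at h
    · rw [hsec x hx, measure_empty]; exact hpos (hradius x)
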